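/- Call a two-qubit density matrix $\sigma$ on $\mathbb{C}^2\otimes\mathbb{C}^2$ *Bell-CHSH local* if it satisfies the Bell-CHSH inequality $$\bigl|\operatorname{Tr}\bigl[\sigma\,(A_0\otimes(B_0+B_1)+A_1\otimes(B_0-B_1))\bigr]\bigr|\le 2$$ for all $\pm1$-valued qubit observables $A_0,A_1,B_0,B_1$ (Hermitian $2\times2$ matrices with square $I$), and *absolutely Bell-CHSH local* if $U\sigma U^\dagger$ is Bell-CHSH local for every unitary $U$ on $\mathbb{C}^2\otimes\mathbb{C}^2$. Let $|\Upsilon\rangle_{ABC}\in\mathbb{C}^2\otimes\mathbb{C}^2\otimes\mathbb{C}^2$ be any unit vector (a pure three-qubit state), and let $\sigma_{AB}=\operatorname{Tr}_C|\Upsilon\rangle\langle\Upsilon|$ and $\sigma_C=\operatorname{Tr}_{AB}|\Upsilon\rangle\langle\Upsilon|$ be its reduced states. Then $\sigma_{AB}$ is absolutely Bell-CHSH local if and only if $\sigma_C$ is maximally mixed, i.e. $\sigma_C=I/2$. -/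

import Mathlib

open scoped Matrix Kronecker

/-- A qubit index set; the computational basis is labelled by `0` and `1`. -/
abbrev Qubit : Type := Fin 2

/-- The density matrix `|ψ⟩⟨ψ|` of a vector `ψ`, with entries `ψ i * conj (ψ j)`. -/
def pureState {ι : Type*} (ψ : EuclideanSpace ℂ ι) : Matrix ι ι ℂ :=
  Matrix.of fun i j => ψ i * star (ψ j)

/-- Partial trace over the second tensor factor: the reduced matrix on the first one. -/
def partialTraceSnd {m n : Type*} [Fintype n] (ρ : Matrix (m × n) (m × n) ℂ) : Matrix m m ℂ :=
  Matrix.of fun i j => ∑ k, ρ (i, k) (j, k)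

/-- Partial trace over the first tensor factor: the reduced matrix on the second one. -/
def partialTraceFst {m n : Type*} [Fintype m] (ρ : Matrix (m × n) (m × n) ℂ) : Matrix n n ℂ :=
  Matrix.of fun i j => ∑ k, ρ (k, i) (k, j)

/-- The maximally mixed state `I / d` on a `d`-dimensional system. -/
noncomputable def maximallyMixed (n : Type*) [Fintype n] [DecidableEq n] : Matrix n n ℂ :=
  (Fintype.card n : ℂ)⁻¹ • (1 : Matrix n n ℂ)

/-- A dichotomic (`±1`-valued) observable of one qubit: a Hermitian matrix with square `1`. -/
def IsDichotomic (A : Matrix Qubit Qubit ℂ) : Prop :=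
  A.IsHermitian ∧ A * A = 1

/-- The Bell-CHSH operator `A₀ ⊗ (B₀ + B₁) + A₁ ⊗ (B₀ - B₁)` of two pairs of observables. -/
def chshOperator (A₀ A₁ B₀ B₁ : Matrix Qubit Qubit ℂ) :
    Matrix (Qubit × Qubit) (Qubit × Qubit) ℂ :=
  A₀ ⊗ₖ (B₀ + B₁) + A₁ ⊗ₖ (B₀ - B₁)

/-- A two-qubit state is Bell-CHSH local if it satisfies the Bell-CHSH inequality
`|⟨A₀B₀⟩ + ⟨A₀B₁⟩ + ⟨A₁B₀⟩ - ⟨A₁B₁⟩| ≤ 2` for every choice of local `±1`-valued observables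
`A₀, A₁` of the first and `B₀, B₁` of the second qubit. -/
def BellCHSHLocal (σ : Matrix (Qubit × Qubit) (Qubit × Qubit) ℂ) : Prop :=
  ∀ A₀ A₁ B₀ B₁ : Matrix Qubit Qubit ℂ,
    IsDichotomic A₀ → IsDichotomic A₁ → IsDichotomic B₀ → IsDichotomic B₁ →
      |(σ * chshOperator A₀ A₁ B₀ B₁).trace.re| ≤ 2

/-- A two-qubit state is absolutely Bell-CHSH local if it stays Bell-CHSH local under every
global unitary `U`. -/
def AbsolutelyBellCHSHLocal (σ : Matrix (Qubit × Qubit) (Qubit × Qubit) ℂ) : Prop :=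
  ∀ U ∈ Matrix.unitaryGroup (Qubit × Qubit) ℂ, BellCHSHLocal (U * σ * Uᴴ)

/-! Reshape the state into a 4×2 matrix `M`: the reduced states are `M * Mᴴ` and `(Mᴴ * M)ᵀ`, so
they share their purity, and the first has rank at most two. If the qubit is maximally mixed, then
σ² = σ/2, a unitarily invariant condition, and Hilbert–Schmidt positivity bounds every CHSH value by
2 (`bellCHSHLocal_of_mul_self`). Conversely, rotate the eigenvectors with eigenvalues p, q to Φ⁺,
Φ⁻. Suitable observables give 2c(p+q) + 2s(p-q) for any unit vector (c, s), so locality forces p² +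
q² ≤ 1/2 (`trace_mul_self_re_le_of_rank_le_two`). A qubit state of such purity is I/2. -/

/-- The coefficient matrix of a bipartite vector. -/
def coeffMatrix {m n : Type*} (ψ : EuclideanSpace ℂ (m × n)) : Matrix m n ℂ :=
  Matrix.of fun i j => ψ (i, j)

theorem partialTraceSnd_pureState {m n : Type*} [Fintype n] (ψ : EuclideanSpace ℂ (m × n)) :
    partialTraceSnd (pureState ψ) = coeffMatrix ψ * (coeffMatrix ψ)ᴴ := by
  ext i j
  simp [partialTraceSnd, pureState, coeffMatrix, Matrix.mul_apply]

theorem partialTraceFst_pureState {m n : Type*} [Fintype m] (ψ : EuclideanSpace ℂ (m × n)) :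
    partialTraceFst (pureState ψ) = ((coeffMatrix ψ)ᴴ * coeffMatrix ψ)ᵀ := by
  ext i j
  simp [partialTraceFst, pureState, coeffMatrix, Matrix.mul_apply, mul_comm]

theorem trace_gram_coeffMatrix {m n : Type*} [Fintype m] [Fintype n]
    (ψ : EuclideanSpace ℂ (m × n)) (hψ : ‖ψ‖ = 1) :
    ((coeffMatrix ψ)ᴴ * coeffMatrix ψ).trace = 1 := by
  have h : ∑ i, ‖ψ i‖ ^ 2 = 1 := by rw [← EuclideanSpace.norm_sq_eq, hψ, one_pow]
  have h' : ∑ i, ((‖ψ i‖ : ℂ)) ^ 2 = 1 := by exact_mod_cast h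
  rw [Fintype.sum_prod_type, Finset.sum_comm] at h'
  simpa [Matrix.trace, Matrix.mul_apply, coeffMatrix, Complex.conj_mul'] using h'

theorem maximallyMixed_qubit : maximallyMixed Qubit = (2⁻¹ : ℂ) • (1 : Matrix Qubit Qubit ℂ) := by
  simp [maximallyMixed]

open scoped ComplexOrder in
theorem trace_conjTranspose_mul_self_re_nonneg {m n : Type*} [Fintype m] [Fintype n]
    (X : Matrix m n ℂ) : 0 ≤ (Xᴴ * X).trace.re :=
  (Complex.le_def.1 (Matrix.posSemidef_conjTranspose_mul_self X).trace_nonneg).1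

/-- The entries of A² = 1 show that the off-diagonal entries and the diagonal difference vanish when
multiplied by the trace; a nonzero trace thus makes A scalar. -/
theorem IsDichotomic.trace_eq_zero_or_commute {A : Matrix Qubit Qubit ℂ} (hA : IsDichotomic A) :
    A.trace = 0 ∨ ∀ X, A * X = X * A := by
  have h := hA.2
  have h00 := congrFun (congrFun h 0) 0
  have h01 := congrFun (congrFun h 0) 1
  have h10 := congrFun (congrFun h 1) 0
  have h11 := congrFun (congrFun h 1) 1
  simp [Matrix.mul_apply, Fin.sum_univ_two] at h00 h01 h10 h11
  by_cases ht : A 0 0 + A 1 1 = 0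
  · left
    simpa [Matrix.trace, Fin.sum_univ_two] using ht
  · right
    have hb : A 0 1 = 0 := (mul_eq_zero.1 (show A 0 1 * (A 0 0 + A 1 1) = 0 by
      linear_combination h01)).resolve_right ht
    have hc : A 1 0 = 0 := (mul_eq_zero.1 (show A 1 0 * (A 0 0 + A 1 1) = 0 by
      linear_combination h10)).resolve_right ht
    have hd : A 0 0 - A 1 1 = 0 := (mul_eq_zero.1
      (show (A 0 0 - A 1 1) * (A 0 0 + A 1 1) = 0 by
        linear_combination h00 - h11)).resolve_right ht
    have hA' : A = A 0 0 • (1 : Matrix Qubit Qubit ℂ) := by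
      ext i j
      fin_cases i <;> fin_cases j <;> simp [hb, hc]
      linear_combination -hd
    intro X
    rw [hA']
    simp

theorem chshOperator_isHermitian {A₀ A₁ B₀ B₁ : Matrix Qubit Qubit ℂ} (hA₀ : A₀.IsHermitian)
    (hA₁ : A₁.IsHermitian) (hB₀ : B₀.IsHermitian) (hB₁ : B₁.IsHermitian) :
    (chshOperator A₀ A₁ B₀ B₁).IsHermitian := by
  simp only [Matrix.IsHermitian, chshOperator, Matrix.conjTranspose_add,
    Matrix.conjTranspose_kronecker, Matrix.conjTranspose_sub, hA₀.eq, hA₁.eq, hB₀.eq, hB₁.eq]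

theorem trace_chshOperator {A₀ A₁ : Matrix Qubit Qubit ℂ} (B₀ B₁ : Matrix Qubit Qubit ℂ)
    (hA₀ : A₀.trace = 0) (hA₁ : A₁.trace = 0) : (chshOperator A₀ A₁ B₀ B₁).trace = 0 := by
  simp [chshOperator, Matrix.trace_add, Matrix.trace_kronecker, hA₀, hA₁]

/-- The square of the Bell-CHSH operator, in terms of the commutators of the observables. -/
theorem chshOperator_mul_self {A₀ A₁ B₀ B₁ : Matrix Qubit Qubit ℂ} (hA₀ : A₀ * A₀ = 1)
    (hA₁ : A₁ * A₁ = 1) (hB₀ : B₀ * B₀ = 1) (hB₁ : B₁ * B₁ = 1) :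
    chshOperator A₀ A₁ B₀ B₁ * chshOperator A₀ A₁ B₀ B₁ =
      (4 : ℂ) • 1 - (A₀ * A₁ - A₁ * A₀) ⊗ₖ (B₀ * B₁ - B₁ * B₀) := by
  have hS : (B₀ + B₁) * (B₀ + B₁) = (4 : ℂ) • 1 - (B₀ - B₁) * (B₀ - B₁) := by
    simp only [mul_add, add_mul, mul_sub, sub_mul, hB₀, hB₁]
    module
  have h1 : (B₀ + B₁) * (B₀ - B₁) = -(B₀ * B₁ - B₁ * B₀) := by
    simp only [add_mul, mul_sub, hB₀, hB₁]
    abel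
  have h2 : (B₀ - B₁) * (B₀ + B₁) = B₀ * B₁ - B₁ * B₀ := by
    simp only [mul_add, sub_mul, hB₀, hB₁]
    abel
  simp only [chshOperator, mul_add, add_mul, ← Matrix.mul_kronecker_mul] at *
  rw [hA₀, hA₁, h1, h2, hS]
  ext ⟨i, j⟩ ⟨k, l⟩
  simp [Matrix.kroneckerMap_apply, Matrix.one_apply, Prod.ext_iff]
  split_ifs <;> simp_all <;> ring

/-- A two-qubit state of rank two with flat spectrum satisfies the Bell-CHSH inequality. -/
theorem bellCHSHLocal_of_mul_self {σ : Matrix (Qubit × Qubit) (Qubit × Qubit) ℂ}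
    (hσ : σ.IsHermitian) (hσ2 : σ * σ = (2⁻¹ : ℂ) • σ) (htr : σ.trace = 1) :
    BellCHSHLocal σ := by
  intro A₀ A₁ B₀ B₁ hA₀ hA₁ hB₀ hB₁
  have hBh := chshOperator_isHermitian hA₀.1 hA₁.1 hB₀.1 hB₁.1
  have hsq := chshOperator_mul_self hA₀.2 hA₁.2 hB₀.2 hB₁.2
  set B := chshOperator A₀ A₁ B₀ B₁ with hB
  have h1 : (1 : Matrix (Qubit × Qubit) (Qubit × Qubit) ℂ).trace = 4 := by
    simp [Matrix.trace_one]
  have hcomm : A₀ * A₁ = A₁ * A₀ ∨ B.trace = 0 := by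
    rcases hA₀.trace_eq_zero_or_commute with h₀ | h₀
    · rcases hA₁.trace_eq_zero_or_commute with h₁ | h₁
      · exact Or.inr (trace_chshOperator _ _ h₀ h₁)
      · exact Or.inl (h₁ _).symm
    · exact Or.inl (h₀ _)
  -- The sign ε = ±1 handles both sides of the absolute value.
  have key : ∀ ε : ℝ, ε * ε = 1 → 0 ≤ 2 - ε * (σ * B).trace.re := by
    intro ε hε
    have hεc : (ε : ℂ) * ε = 1 := by exact_mod_cast hε
    rcases hcomm with h | h
    · rw [h, sub_self, Matrix.zero_kronecker, sub_zero] at hsq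
      -- Here B² = 4, so (B - 2ε)² = 8 - 4εB, and positivity of its σ²-trace gives the bound.
      set X := (B - (2 * ε : ℂ) • 1) * σ with hX
      have hXh : Xᴴ = σ * (B - (2 * ε : ℂ) • 1) := by
        simp [hX, Matrix.conjTranspose_mul, hσ.eq, hBh.eq]
      have hX2 : (Xᴴ * X).trace = 4 - 2 * ε * (σ * B).trace := by
        have e : (B - (2 * ε : ℂ) • 1) * (B - (2 * ε : ℂ) • 1)
            = (8 : ℂ) • 1 - (4 * ε : ℂ) • B := by
          simp only [mul_sub, sub_mul, hsq, smul_mul_assoc, mul_smul_comm, one_mul, mul_one,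
            smul_sub, smul_smul]
          rw [show (2 * ε * (2 * ε) : ℂ) = 4 by linear_combination 4 * hεc]
          module
        rw [hXh, hX, Matrix.trace_mul_comm, Matrix.mul_assoc, ← Matrix.mul_assoc σ σ, hσ2,
          Matrix.trace_mul_comm, Matrix.mul_assoc, e]
        simp [mul_sub, Matrix.trace_sub, htr]
        ring
      have := trace_conjTranspose_mul_self_re_nonneg X
      rw [hX2] at this
      simp at this
      linarith
    -- Cauchy–Schwarz for traceless matrices: 4σ - 1 squares to 1, so B and 2ε(4σ - 1) both have
    -- squared norm 16.
    · set X := B - (2 * ε : ℂ) • ((4 : ℂ) • σ - 1) with hX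
      have hXh : Xᴴ = X := by
        simp [hX, hσ.eq, hBh.eq]
      have hBB : (B * B).trace = 16 := by
        rw [hsq]
        simp [Matrix.trace_sub, Matrix.trace_kronecker, h1, Matrix.trace_mul_comm A₀ A₁]
        norm_num
      have hX2 : (Xᴴ * X).trace = 32 - 16 * ε * (σ * B).trace := by
        rw [hXh, hX]
        simp only [mul_sub, sub_mul, smul_mul_assoc, mul_smul_comm, one_mul, mul_one, smul_smul,
          hσ2, Matrix.trace_sub, Matrix.trace_smul, hBB, smul_sub, htr, h1, h,
          Matrix.trace_mul_comm B σ, smul_eq_mul]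
        linear_combination 16 * hεc
      have := trace_conjTranspose_mul_self_re_nonneg X
      rw [hX2] at this
      simp at this
      linarith
  have k1 := key 1 (by norm_num)
  have k2 := key (-1) (by norm_num)
  rw [abs_le]
  constructor <;> linarith

theorem absolutelyBellCHSHLocal_of_mul_self {σ : Matrix (Qubit × Qubit) (Qubit × Qubit) ℂ}
    (hσ : σ.IsHermitian) (hσ2 : σ * σ = (2⁻¹ : ℂ) • σ) (htr : σ.trace = 1) :
    AbsolutelyBellCHSHLocal σ := by
  intro U hU
  have hU' : Uᴴ * U = 1 := Matrix.mem_unitaryGroup_iff'.1 hU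
  refine bellCHSHLocal_of_mul_self ?_ ?_ ?_
  · simp [Matrix.IsHermitian, Matrix.conjTranspose_mul, hσ.eq, Matrix.mul_assoc]
  · calc U * σ * Uᴴ * (U * σ * Uᴴ) = U * σ * (Uᴴ * U) * σ * Uᴴ := by
          simp only [Matrix.mul_assoc]
      _ = U * (σ * σ) * Uᴴ := by rw [hU', Matrix.mul_one, Matrix.mul_assoc U]
      _ = _ := by simp [hσ2]
  · rw [Matrix.trace_mul_comm, ← Matrix.mul_assoc, hU', Matrix.one_mul, htr]

/-! ### Bell-diagonal states and CHSH violation -/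

/-- The unitary matrix whose columns are the Bell states `Φ⁺, Φ⁻, Ψ⁺, Ψ⁻`. -/
noncomputable def bellMatrix : Matrix (Qubit × Qubit) (Qubit × Qubit) ℂ :=
  Matrix.of fun x k =>
    if x.1 + x.2 = k.1 then (if x.1 = 1 ∧ k.2 = 1 then -1 else 1) * ((√2 : ℝ) : ℂ)⁻¹ else 0

theorem inv_sqrt_two_mul_self : ((√2 : ℝ) : ℂ)⁻¹ * ((√2 : ℝ) : ℂ)⁻¹ = 2⁻¹ := by
  rw [← mul_inv, ← Complex.ofReal_mul, Real.mul_self_sqrt (by norm_num)]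
  norm_num

theorem bellMatrix_mem_unitaryGroup : bellMatrix ∈ Matrix.unitaryGroup (Qubit × Qubit) ℂ := by
  rw [Matrix.mem_unitaryGroup_iff]
  ext ⟨i, j⟩ ⟨k, l⟩
  have h := inv_sqrt_two_mul_self
  fin_cases i <;> fin_cases j <;> fin_cases k <;> fin_cases l <;>
    simp [Matrix.mul_apply, Fintype.sum_prod_type, Fin.sum_univ_two, bellMatrix,
      Matrix.star_apply, h] <;> norm_num

/-- The observable `c Z + s X` of one qubit. -/
def planarObservable (c s : ℝ) : Matrix Qubit Qubit ℂ := !![(c : ℂ), s; s, -c]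

theorem planarObservable_isDichotomic {c s : ℝ} (h : c ^ 2 + s ^ 2 = 1) :
    IsDichotomic (planarObservable c s) := by
  have h' : (c : ℂ) ^ 2 + (s : ℂ) ^ 2 = 1 := by exact_mod_cast h
  constructor
  · ext i j
    fin_cases i <;> fin_cases j <;> simp [planarObservable]
  · ext i j
    fin_cases i <;> fin_cases j <;> simp [planarObservable, Matrix.mul_apply, Fin.sum_univ_two] <;>
      first | ring1 | linear_combination h'

/-- B₀ + B₁ = 2cZ and B₀ - B₁ = 2sX, so the operator is 2c Z⊗Z + 2s X⊗X, diagonal in the Bell basis.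
-/
theorem trace_bell_diagonal_mul_chshOperator (d : Qubit × Qubit → ℂ) (c s : ℝ) :
    (bellMatrix * Matrix.diagonal d * bellMatrixᴴ *
      chshOperator (planarObservable 1 0) (planarObservable 0 1) (planarObservable c s)
        (planarObservable c (-s))).trace =
      2 * c * (d (0, 0) + d (0, 1) - d (1, 0) - d (1, 1)) +
        2 * s * (d (0, 0) - d (0, 1) + d (1, 0) - d (1, 1)) := by
  have h := inv_sqrt_two_mul_self
  simp [Matrix.trace, Matrix.mul_apply, Matrix.diagonal_apply, Fintype.sum_prod_type,
    Fin.sum_univ_two, bellMatrix, chshOperator, planarObservable, Matrix.kroneckerMap_apply]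
  linear_combination (4 * c * (d (0, 0) + d (0, 1) - d (1, 0) - d (1, 1)) +
        4 * s * (d (0, 0) - d (0, 1) + d (1, 0) - d (1, 1))) * h

theorem sq_add_sq_le_one_of_forall {x y : ℝ}
    (h : ∀ c s : ℝ, c ^ 2 + s ^ 2 = 1 → c * x + s * y ≤ 1) : x ^ 2 + y ^ 2 ≤ 1 := by
  by_contra! hr
  set r := √(x ^ 2 + y ^ 2) with hrdef
  have hr2 : r ^ 2 = x ^ 2 + y ^ 2 := Real.sq_sqrt (by positivity)
  have hr1 : 1 < r := by
    rw [hrdef]; exact Real.lt_sqrt_of_sq_lt (by simpa using hr)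
  have hr0 : r ≠ 0 := by positivity
  -- The unit vector along (x, y) attains the maximum r.
  have := h (x / r) (y / r) (by rw [div_pow, div_pow, ← add_div, ← hr2]; field_simp)
  rw [show x / r * x + y / r * y = r by field_simp; linarith] at this
  linarith

theorem exists_perm_qubit_prod (i j : Qubit × Qubit) (hij : i ≠ j) :
    ∃ e : Equiv.Perm (Qubit × Qubit), e (0, 0) = i ∧ e (0, 1) = j := by
  revert i j
  decide

theorem exists_perm_of_card_support_le_two {d : Qubit × Qubit → ℝ}
    (hd : Fintype.card {i // d i ≠ 0} ≤ 2) :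
    ∃ e : Equiv.Perm (Qubit × Qubit), d (e (1, 0)) = 0 ∧ d (e (1, 1)) = 0 := by
  -- The support may be smaller than two, so it is padded to exactly two indices.
  obtain ⟨t, hst, ht⟩ := Finset.exists_superset_card_eq (s := Finset.univ.filter fun i => d i ≠ 0)
    (n := 2) (by rwa [← Fintype.card_subtype]) (by simp)
  obtain ⟨i, j, hij, rfl⟩ := Finset.card_eq_two.1 ht
  obtain ⟨e, rfl, rfl⟩ := exists_perm_qubit_prod i j hij
  have h : ∀ k, k ≠ (0, 0) → k ≠ (0, 1) → d (e k) = 0 := by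
    intro k h0 h1
    by_contra hk
    have := hst (Finset.mem_filter.2 ⟨Finset.mem_univ _, hk⟩)
    simp [h0, h1] at this
  exact ⟨e, h _ (by decide) (by decide), h _ (by decide) (by decide)⟩

/-- An absolutely Bell-CHSH local two-qubit state of rank at most two has purity at most `1/2`. -/
theorem trace_mul_self_re_le_of_rank_le_two {σ : Matrix (Qubit × Qubit) (Qubit × Qubit) ℂ}
    (hσ : σ.IsHermitian) (hrank : σ.rank ≤ 2) (htr : σ.trace = 1)
    (h : AbsolutelyBellCHSHLocal σ) : (σ * σ).trace.re ≤ 1 / 2 := by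
  rw [hσ.rank_eq_card_non_zero_eigs] at hrank
  obtain ⟨e, h2, h3⟩ := exists_perm_of_card_support_le_two hrank
  set d := hσ.eigenvalues with hd
  set W := hσ.eigenvectorUnitary.1 with hW
  have hWu : W ∈ Matrix.unitaryGroup (Qubit × Qubit) ℂ := hσ.eigenvectorUnitary.2
  set W' := W.submatrix id e with hW'
  set D : Matrix (Qubit × Qubit) (Qubit × Qubit) ℂ :=
    Matrix.diagonal fun i => (d (e i) : ℂ) with hD
  have hW1 : W'ᴴ * W' = 1 := by
    have := Matrix.mem_unitaryGroup_iff'.1 hWu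
    rw [hW', Matrix.conjTranspose_submatrix, ← Matrix.submatrix_mul _ _ _ _ _ Function.bijective_id,
      ← Matrix.star_eq_conjTranspose, this, Matrix.submatrix_one_equiv]
  have hW2 : W' * W'ᴴ = 1 := mul_eq_one_comm.1 hW1
  have hspec : σ = W' * D * W'ᴴ := by
    have hDe : D = (Matrix.diagonal fun i => (d i : ℂ)).submatrix e e := by
      rw [Matrix.submatrix_diagonal_equiv]; rfl
    rw [hDe, hW', Matrix.conjTranspose_submatrix, Matrix.submatrix_mul_equiv,
      Matrix.submatrix_mul_equiv, Matrix.submatrix_id_id]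
    exact hσ.spectral_theorem
  have hcyc : ∀ X, (W' * X * W'ᴴ).trace = X.trace := by
    intro X
    rw [Matrix.trace_mul_comm, ← Matrix.mul_assoc, hW1, Matrix.one_mul]
  have hpq : d (e (0, 0)) + d (e (0, 1)) = 1 := by
    have := htr
    rw [hspec, hcyc, hD, Matrix.trace_diagonal, Fintype.sum_prod_type] at this
    simp [Fin.sum_univ_two, h2, h3] at this
    exact_mod_cast this
  have hpur : (σ * σ).trace.re = d (e (0, 0)) ^ 2 + d (e (0, 1)) ^ 2 := by
    have : σ * σ = W' * (D * D) * W'ᴴ := by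
      calc σ * σ = W' * D * (W'ᴴ * W') * D * W'ᴴ := by
            rw [hspec]; simp only [Matrix.mul_assoc]
        _ = _ := by rw [hW1, Matrix.mul_one, Matrix.mul_assoc W']
    rw [this, hcyc, hD, Matrix.diagonal_mul_diagonal, Matrix.trace_diagonal,
      Fintype.sum_prod_type]
    simp [Fin.sum_univ_two, h2, h3]
    ring
  -- This unitary carries the reordered eigenbasis to the Bell basis.
  have hU : bellMatrix * W'ᴴ ∈ Matrix.unitaryGroup (Qubit × Qubit) ℂ := by
    refine mul_mem bellMatrix_mem_unitaryGroup (Matrix.mem_unitaryGroup_iff.2 ?_)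
    rw [Matrix.star_eq_conjTranspose, Matrix.conjTranspose_conjTranspose, hW1]
  have hUσ : bellMatrix * W'ᴴ * σ * (bellMatrix * W'ᴴ)ᴴ = bellMatrix * D * bellMatrixᴴ := by
    rw [Matrix.conjTranspose_mul, Matrix.conjTranspose_conjTranspose, hspec]
    calc _ = bellMatrix * (W'ᴴ * W') * D * (W'ᴴ * W') * bellMatrixᴴ := by
          simp only [Matrix.mul_assoc]
      _ = _ := by rw [hW1, Matrix.mul_one, Matrix.mul_one]
  have hloc := h _ hU
  rw [hUσ] at hloc
  have := sq_add_sq_le_one_of_forall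
    (x := d (e (0, 0)) + d (e (0, 1))) (y := d (e (0, 0)) - d (e (0, 1))) (by
      intro c s hcs
      have := hloc _ _ _ _ (planarObservable_isDichotomic (c := 1) (s := 0) (by norm_num))
        (planarObservable_isDichotomic (c := 0) (s := 1) (by norm_num))
        (planarObservable_isDichotomic hcs)
        (planarObservable_isDichotomic (c := c) (s := -s) (by rwa [neg_sq]))
      rw [hD, trace_bell_diagonal_mul_chshOperator] at this
      simp [h2, h3] at this
      linarith [(abs_le.1 this).2])
  rw [hpur]
  nlinarith

open scoped ComplexOrder in
-- The squared Hilbert–Schmidt distance from G to I/2 is tr G² - 1/2, hence zero.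
theorem eq_half_smul_one_of_trace_mul_self_le {G : Matrix Qubit Qubit ℂ} (hG : G.IsHermitian)
    (htr : G.trace = 1) (hpur : (G * G).trace.re ≤ 1 / 2) :
    G = (2⁻¹ : ℂ) • (1 : Matrix Qubit Qubit ℂ) := by
  set X := G - (2⁻¹ : ℂ) • (1 : Matrix Qubit Qubit ℂ) with hX
  have hXh : Xᴴ = X := by simp [hX, hG.eq]
  have hX2 : (Xᴴ * X).trace = (G * G).trace - 1 / 2 := by
    rw [hXh, hX]
    simp [mul_sub, sub_mul, Matrix.trace_sub, htr]
  have hps := (Matrix.posSemidef_conjTranspose_mul_self X).trace_nonneg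
  have hz : (Xᴴ * X).trace = 0 := by
    refine le_antisymm ?_ hps
    rw [Complex.le_def] at hps ⊢
    refine ⟨?_, hps.2.symm⟩
    rw [hX2]
    simp at hpur ⊢
    linarith
  exact sub_eq_zero.1 (Matrix.trace_conjTranspose_mul_self_eq_zero_iff.1 hz)

theorem corollary1 (Υ : EuclideanSpace ℂ ((Qubit × Qubit) × Qubit)) (hΥ : ‖Υ‖ = 1) :
    AbsolutelyBellCHSHLocal (partialTraceSnd (pureState Υ)) ↔
      partialTraceFst (pureState Υ) = maximallyMixed Qubit := by
  rw [partialTraceSnd_pureState, partialTraceFst_pureState, maximallyMixed_qubit]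
  have htr := trace_gram_coeffMatrix Υ hΥ
  set M := coeffMatrix Υ
  have hσ : (M * Mᴴ).IsHermitian := Matrix.isHermitian_mul_conjTranspose_self M
  have htr' : (M * Mᴴ).trace = 1 := by rw [Matrix.trace_mul_comm, htr]
  constructor
  · intro h
    have hrank : (M * Mᴴ).rank ≤ 2 :=
      (Matrix.rank_mul_le_left _ _).trans (by simpa using M.rank_le_card_width)
    have hp := trace_mul_self_re_le_of_rank_le_two hσ hrank htr' h
    -- Cyclicity of the trace moves the purity bound from `M * Mᴴ` to `Mᴴ * M`.
    rw [Matrix.mul_assoc, Matrix.trace_mul_comm, ← Matrix.mul_assoc, Matrix.mul_assoc] at hp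
    rw [eq_half_smul_one_of_trace_mul_self_le (Matrix.isHermitian_conjTranspose_mul_self M) htr hp]
    simp
  · intro h
    have hG : Mᴴ * M = (2⁻¹ : ℂ) • (1 : Matrix Qubit Qubit ℂ) := by
      rw [← Matrix.transpose_transpose (Mᴴ * M), h]
      simp
    refine absolutelyBellCHSHLocal_of_mul_self hσ ?_ htr'
    rw [Matrix.mul_assoc, ← Matrix.mul_assoc Mᴴ, hG]
    simp
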